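/- For nonzero integers $m,n$ let $BS(m,n)=\langle a,b\mid ba^mb^{-1}=a^n\rangle$. If $n=m+1$ or $n=m-1$, then the integral group ring $\mathbb{Z}BS(m,n)$ has a (right) module that is stably free of rank one but not free, where a module $M$ over a ring $R$ is called stably free of rank $d$ if $M\oplus R^k\cong R^{d+k}$ for some $k\ge 0$. Explicitly, such a module is the kernel of the homomorphism of right $\mathbb{Z}BS(m,n)$-modules $\lambda:(\mathbb{Z}BS(m,n))^2\to\mathbb{Z}BS(m,n)$ given by $(1,0)\mapsto 1+a^m$ and $(0,1)\mapsto b+1+a^n$. -/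

import Mathlib

/-- The Baumslag-Solitar group `BS(m,n) = ⟨a, b ∣ b a^m b⁻¹ = a^n⟩`. The generators `a` and `b` of the
free group are indexed by `0` and `1`. -/
abbrev BaumslagSolitar (m n : ℤ) : Type :=
  PresentedGroup
    ({FreeGroup.of 1 * FreeGroup.of 0 ^ m * (FreeGroup.of 1)⁻¹ * (FreeGroup.of 0 ^ n)⁻¹} :
      Set (FreeGroup (Fin 2)))

namespace BaumslagSolitar

/-- The generator `a`. -/
def a (m n : ℤ) : BaumslagSolitar m n := PresentedGroup.of 0

/-- The generator `b`. -/
def b (m n : ℤ) : BaumslagSolitar m n := PresentedGroup.of 1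

/-- The integral group ring `ℤBS(m,n)`. -/
abbrev GroupRing (m n : ℤ) : Type := MonoidAlgebra ℤ (BaumslagSolitar m n)

/-- The element `1 + a^m` of `ℤBS(m,n)`. -/
noncomputable def r (m n : ℤ) : GroupRing m n :=
  1 + MonoidAlgebra.of ℤ (BaumslagSolitar m n) (a m n ^ m)

/-- The element `b + 1 + a^n` of `ℤBS(m,n)`. -/
noncomputable def t (m n : ℤ) : GroupRing m n :=
  MonoidAlgebra.of ℤ (BaumslagSolitar m n) (b m n) + 1
    + MonoidAlgebra.of ℤ (BaumslagSolitar m n) (a m n ^ n)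

/-- The homomorphism of right `ℤBS(m,n)`-modules `(ℤBS(m,n))² → ℤBS(m,n)` with
`(1,0) ↦ 1 + a^m` and `(0,1) ↦ b + 1 + a^n`. Right modules are modules over the opposite ring, which
acts on the ring by multiplication on the right. -/
noncomputable def lam (m n : ℤ) :
    (GroupRing m n × GroupRing m n) →ₗ[(GroupRing m n)ᵐᵒᵖ] GroupRing m n where
  toFun p := r m n * p.1 + t m n * p.2
  map_add' p q := by
    simp only [Prod.fst_add, Prod.snd_add, mul_add]
    abel
  map_smul' c p := by
    simp only [Prod.smul_fst, Prod.smul_snd, MulOpposite.smul_eq_mul_unop, RingHom.id_apply,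
      add_mul, mul_assoc]

end BaumslagSolitar

/-- `M` is stably free of rank `d` over `R`: `M ⊕ R^k ≅ R^(d+k)` for some natural number `k`. -/
def IsStablyFreeOfRank (R : Type*) [Ring R] (M : Type*) [AddCommGroup M] [Module R M] (d : ℕ) :
    Prop :=
  ∃ k : ℕ, Nonempty ((M × (Fin k → R)) ≃ₗ[R] (Fin (d + k) → R))

/-! Put r = 1 + a^m and s = 1 + a^n. Since b r = s b and r, s commute, λ splits for all m and n
(`exists_lam_eq_one`), so its kernel is stably free of rank one. If the kernel were free, invariant
basis number would make it cyclic, so the right ideal of all y with (b + s) y in the right ideal of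
r would be principal. The splitting carries this along any ring homomorphism
(`exists_generator_of_free_ker_lam`). Map to ℤ[ℚ] ⋊ ℚ_{>0}, with a ↦ x and b ↦ scaling of exponents
by β = n/m. There the ideal contains a nonzero monomial, so its generator is a monomial cτ, and r ∣
β • c. As 2 lies in (r, s), the ideal also contains an element with coefficient 2r at 1, so c ∣ 2r
and hence r ∣ 2s (`not_exists_generator`). But x = exp(πi/m) kills r and not 2s (`not_one_add_dvd`).
-/

namespace SkewMonoidAlgebra

/-! ### Monomials and principal right ideals in skew group rings -/

variable {k G : Type*}

/-- The coefficient of a skew product at a group element that is reached in only one way. -/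
theorem coeff_mul_mul_of_uniqueMul [Semiring k] [Mul G] [SMulZeroClass G k]
    {f g : SkewMonoidAlgebra k G} {x y : G} (h : UniqueMul f.support g.support x y) :
    (f * g).coeff (x * y) = f.coeff x * x • g.coeff y := by
  classical
  rw [coeff_mul]
  simp only [sum_def, Finsupp.sum, support_coeff]
  rw [← Finset.sum_product']
  refine (Finset.sum_eq_single (x, y) ?_ ?_).trans (if_pos rfl) <;> simp_rw [Finset.mem_product]
  · refine fun ab hab hne ↦ if_neg fun he ↦ hne <| Prod.ext ?_ ?_
    exacts [(h hab.1 hab.2 he).1, (h hab.1 hab.2 he).2]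
  · refine fun hmem ↦ ite_eq_right_iff.mpr fun _ ↦ ?_
    rcases not_and_or.mp hmem with hx | hy
    · rw [notMem_support_iff.mp hx, zero_mul]
    · rw [notMem_support_iff.mp hy, smul_zero, mul_zero]

/-- A left divisor of a monomial in a skew group ring over a domain is a monomial. -/
theorem exists_eq_single_of_mul_eq_single [Semiring k] [NoZeroDivisors k] [Group G]
    [TwoUniqueProds G] [MulSemiringAction G k] {v s : SkewMonoidAlgebra k G} {g : G} {d : k}
    (hd : d ≠ 0) (h : v * s = single g d) : ∃ x c, v = single x c := by
  classical
  have hprod : v * s ≠ 0 := h ▸ mt single_eq_zero.mp hd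
  have hv : v.support.Nonempty := by
    rw [Finset.nonempty_iff_ne_empty, ne_eq, support_eq_empty]
    rintro rfl
    exact hprod (zero_mul _)
  have hs : s.support.Nonempty := by
    rw [Finset.nonempty_iff_ne_empty, ne_eq, support_eq_empty]
    rintro rfl
    exact hprod (mul_zero _)
  have key : ∀ x ∈ v.support, ∀ y ∈ s.support, UniqueMul v.support s.support x y →
      x * y = g := by
    intro x hx y hy hu
    have h1 := coeff_mul_mul_of_uniqueMul hu
    rw [h, coeff_single_apply] at h1
    by_contra hne
    rw [if_neg (Ne.symm hne)] at h1
    refine mul_ne_zero (mem_support_iff.mp hx) ?_ h1.symm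
    rw [ne_eq, smul_eq_zero_iff_eq]
    exact mem_support_iff.mp hy
  -- Two distinct unique products would both give nonzero coefficients, so both would equal `g`,
  -- against uniqueness.
  have hcard : ¬ 1 < v.support.card * s.support.card := by
    intro hlt
    obtain ⟨p₁, h₁, p₂, h₂, hne, hu₁, hu₂⟩ := TwoUniqueProds.uniqueMul_of_one_lt_card hlt
    rw [Finset.mem_product] at h₁ h₂
    have e := (key _ h₂.1 _ h₂.2 hu₂).trans (key _ h₁.1 _ h₁.2 hu₁).symm
    obtain ⟨e₁, e₂⟩ := hu₁ h₂.1 h₂.2 e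
    exact hne (Prod.ext e₁ e₂).symm
  have hv1 : v.support.card = 1 := by
    have := hv.card_pos
    have := hs.card_pos
    nlinarith
  obtain ⟨x, hx⟩ := Finset.card_eq_one.mp hv1
  refine ⟨x, v.coeff x, ?_⟩
  ext y
  rw [coeff_single_apply]
  split_ifs with hxy
  · rw [hxy]
  · rw [← notMem_support_iff, hx, Finset.mem_singleton]
    exact fun e ↦ hxy e.symm

/-- In the skew group ring `S` of a domain, the right ideal of those `y` with
`(b + β • r) * y ∈ r * S`, where `b` is the monomial of `β`, is not principal when the ideal
`(r, β⁻¹ • r)` contains some `β • w` such that `r` does not divide `β • (w * r)`. -/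
theorem not_exists_generator [CommRing k] [IsDomain k] [Group G] [TwoUniqueProds G]
    [MulSemiringAction G k] {β : G} (hβ : β ≠ 1) {r p q w : k}
    (hw : β • w = p * r + q * β⁻¹ • r) (hdvd : ¬ r ∣ β • (w * r)) :
    ¬ ∃ v : SkewMonoidAlgebra k G,
      (∃ x, single 1 r * x + (single β 1 + single 1 (β • r)) * v = 0) ∧
      ∀ x y, single 1 r * x + (single β 1 + single 1 (β • r)) * y = 0 → ∃ z, y = v * z := by
  rintro ⟨v, ⟨x, hx⟩, hgen⟩
  have hr : r ≠ 0 := by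
    rintro rfl
    simp at hdvd
  -- Moving `r * β⁻¹ • r` past β turns it into `β • r * r`, so both terms stay divisible by `r`.
  obtain ⟨s, hs⟩ := hgen (-(single β (β • r) + single 1 (β • r * β⁻¹ • r)))
    (single 1 (r * β⁻¹ • r)) (by
      simp only [mul_neg, mul_add, add_mul, single_mul_single, one_smul, one_mul, mul_one,
        smul_mul', smul_inv_smul]
      rw [mul_comm (β • r) r, mul_left_comm (β • r) r]
      abel)
  obtain ⟨τ, c, rfl⟩ := exists_eq_single_of_mul_eq_single
    (mul_ne_zero hr (mt (smul_eq_zero_iff_eq _).mp hr)) hs.symm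
  -- Compare coefficients at `β * τ`; the term from `β • r` sits at `τ`, elsewhere since `β ≠ 1`.
  have hrc : r ∣ β • c := by
    have h := congrArg (fun f ↦ f.coeff (β * τ)) hx
    simp only [coeff_add, add_mul, single_mul_single, one_mul, one_smul, Finsupp.add_apply,
      coeff_single_one_mul, coeff_zero, Finsupp.zero_apply, coeff_single, Finsupp.single_eq_same]
      at h
    rw [Finsupp.single_eq_of_ne (by simpa using hβ), add_zero] at h
    exact ⟨-(x.coeff (β * τ)), by linear_combination h⟩
  -- The only coefficient not visibly divisible by `r` is that at β, namely `β • r * (β • w - q *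
  -- β⁻¹ • r)`, and `hw` makes it `β • r * p * r`.
  obtain ⟨z, hz⟩ := hgen
    (-(single β (β • r * p) + single 1 (β • r * w) - single (β * β) (β • q)))
    (single 1 (w * r) + single β (-(q * β⁻¹ • r))) (by
      have h : single β (β • w * β • r) =
          single β (r * (β • r * p)) + single β (β • r * (q * β⁻¹ • r)) := by
        rw [← single_add]
        congr 1
        linear_combination (β • r) * hw
      simp only [mul_neg, mul_add, mul_sub, add_mul, single_mul_single, one_smul, one_mul, mul_one,
        smul_mul', smul_inv_smul, single_neg]
      rw [h, mul_comm (β • q) r, mul_left_comm r (β • r) w, mul_comm r w]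
      abel)
  have hcw : c ∣ w * r := by
    have h := congrArg (fun f ↦ f.coeff 1) hz
    simp only [coeff_add, Finsupp.add_apply, coeff_single, Finsupp.single_eq_same,
      coeff_single_mul] at h
    rw [Finsupp.single_eq_of_ne hβ.symm, add_zero] at h
    exact ⟨_, h⟩
  obtain ⟨d, hd⟩ := hcw
  exact hdvd (hrc.trans ⟨β • d, by rw [hd, smul_mul']⟩)

end SkewMonoidAlgebra

/-! ### Stable freeness, invariant basis number and split kernels -/

/-- Invariant basis number descends along ring homomorphisms. -/
theorem RingHom.invariantBasisNumber {R S : Type*} [Semiring R] [Semiring S]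
    [InvariantBasisNumber S] (f : R →+* S) : InvariantBasisNumber R := by
  rw [invariantBasisNumber_iff_matrix]
  intro n m M N h₁ h₂
  refine invariantBasisNumber_iff_matrix.mp ‹InvariantBasisNumber S› n m (M.map f) (N.map f) ?_ ?_
  · rw [← Matrix.map_mul, h₁, Matrix.map_one f f.map_zero f.map_one]
  · rw [← Matrix.map_mul, h₂, Matrix.map_one f f.map_zero f.map_one]

/-- A free module that is stably free of rank one over a ring with invariant basis number is
generated by one element. -/
theorem IsStablyFreeOfRank.exists_generator {R M : Type*} [Ring R] [InvariantBasisNumber R]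
    [AddCommGroup M] [Module R M] [Module.Free R M] (h : IsStablyFreeOfRank R M 1) :
    ∃ e : M, ∀ x : M, ∃ c : R, x = c • e := by
  obtain ⟨k, ⟨f⟩⟩ := h
  have : Module.Finite R M :=
    Module.Finite.of_surjective (LinearMap.fst R M (Fin k → R) ∘ₗ f.symm.toLinearMap)
      (Prod.fst_surjective.comp f.symm.surjective)
  have : Nontrivial R := nontrivial_of_invariantBasisNumber R
  let B := Module.Free.chooseBasis R M
  have hcard := card_eq_of_linearEquiv R
    ((B.prod (Pi.basisFun R (Fin k))).equivFun.symm ≪≫ₗ f)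
  rw [Fintype.card_sum, Fintype.card_fin, Fintype.card_fin, Nat.add_right_cancel_iff,
    Fintype.card_eq_one_iff] at hcard
  obtain ⟨i, hi⟩ := hcard
  have : Unique (Module.Free.ChooseBasisIndex R M) := ⟨⟨i⟩, hi⟩
  refine ⟨B default, fun x ↦ ⟨B.repr x default, ?_⟩⟩
  conv_lhs => rw [← B.sum_repr x]
  rw [Fintype.sum_unique]

theorem IsStablyFreeOfRank.isStablyFree {R M : Type*} [Ring R] [AddCommGroup M] [Module R M]
    {d : ℕ} (h : IsStablyFreeOfRank R M d) : Module.IsStablyFree R M := by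
  obtain ⟨k, ⟨f⟩⟩ := h
  have : Module.Free R (M × (Fin k → R)) := Module.Free.of_equiv f.symm
  exact Module.IsStablyFree.of_free_prod R M (Fin k → R)

/-- The kernel of a split surjection, together with the target, makes up the source. -/
noncomputable def LinearMap.kerProdEquivOfRightInverse {R M N : Type*} [Ring R] [AddCommGroup M]
    [AddCommGroup N] [Module R M] [Module R N] (f : M →ₗ[R] N) (g : N →ₗ[R] M)
    (h : ∀ x, f (g x) = x) : (LinearMap.ker f × N) ≃ₗ[R] M where
  toFun p := p.1 + g p.2
  map_add' p q := by
    simp only [Prod.fst_add, Prod.snd_add, Submodule.coe_add, map_add]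
    abel
  map_smul' c p := by simp
  invFun x := (⟨x - g (f x), by simp [h]⟩, f x)
  left_inv p := by
    have : f p.1 = 0 := p.1.2
    ext <;> simp [h, this]
  right_inv x := by simp

/-- The regular right module of `R` is the regular left module of the opposite ring. -/
def MulOpposite.opLinearEquivSelf (R : Type*) [Ring R] : R ≃ₗ[Rᵐᵒᵖ] Rᵐᵒᵖ where
  __ := MulOpposite.opAddEquiv
  map_smul' c x := by
    simp [MulOpposite.smul_eq_mul_unop]

/-! ### The kernel of λ and its base change -/

namespace BaumslagSolitar

variable (m n : ℤ)

theorem b_mul_a_zpow : b m n * a m n ^ m = a m n ^ n * b m n := by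
  have h : b m n * a m n ^ m * (b m n)⁻¹ * (a m n ^ n)⁻¹ = 1 :=
    PresentedGroup.one_of_mem (Set.mem_singleton _)
  rwa [mul_inv_eq_one, mul_inv_eq_iff_eq_mul] at h

theorem of_b_mul_r : MonoidAlgebra.of ℤ (BaumslagSolitar m n) (b m n) * r m n =
    (1 + MonoidAlgebra.of ℤ (BaumslagSolitar m n) (a m n ^ n)) *
      MonoidAlgebra.of ℤ (BaumslagSolitar m n) (b m n) := by
  rw [r, mul_add, add_mul, ← map_mul, ← map_mul, b_mul_a_zpow, mul_one, one_mul]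

theorem exists_lam_eq_one : ∃ p, lam m n p = 1 := by
  let β := MonoidAlgebra.of ℤ (BaumslagSolitar m n) (b m n)
  let β' := MonoidAlgebra.of ℤ (BaumslagSolitar m n) (b m n)⁻¹
  let s := 1 + MonoidAlgebra.of ℤ (BaumslagSolitar m n) (a m n ^ n)
  have h : β * β' = 1 := by rw [← map_mul, mul_inv_cancel, map_one]
  have ht : t m n = β + s := add_assoc _ _ _
  have hr : β * r m n = s * β := of_b_mul_r m n
  -- `β'` alone gives 1 + sβ'. The error sβ' equals βrβ'², so subtracting rβ'² removes it and leaves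
  -- -srβ'², which the first coordinate cancels.
  refine ⟨(s * (β' * β'), β' - r m n * (β' * β')), ?_⟩
  change r m n * (s * (β' * β')) + t m n * (β' - r m n * (β' * β')) = 1
  have e : (β + s) * (β' - r m n * (β' * β')) =
      β * β' + s * β' - (β * r m n) * (β' * β') - s * r m n * (β' * β') := by
    noncomm_ring
  have e' : s * β * (β' * β') = s * β' := by
    rw [mul_assoc, ← mul_assoc β, h, one_mul]
  have hc : Commute (r m n) s := by
    have : Commute (MonoidAlgebra.of ℤ (BaumslagSolitar m n) (a m n ^ m))
        (MonoidAlgebra.of ℤ (BaumslagSolitar m n) (a m n ^ n)) :=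
      (Commute.zpow_zpow_self (a m n) m n).map _
    exact ((Commute.one_left _).add_left ((Commute.one_right _).add_right this))
  rw [ht, e, h, hr, e', ← hc.eq]
  noncomm_ring

theorem isStablyFreeOfRank_ker_lam :
    IsStablyFreeOfRank (GroupRing m n)ᵐᵒᵖ (LinearMap.ker (lam m n)) 1 := by
  obtain ⟨p, hp⟩ := exists_lam_eq_one m n
  let g : GroupRing m n →ₗ[(GroupRing m n)ᵐᵒᵖ] GroupRing m n × GroupRing m n :=
    { toFun := fun x ↦ MulOpposite.op x • p
      map_add' := fun x y ↦ by rw [MulOpposite.op_add, add_smul]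
      map_smul' := fun c x ↦ by
        rw [RingHom.id_apply, ← mul_smul, MulOpposite.smul_eq_mul_unop, MulOpposite.op_mul,
          MulOpposite.op_unop] }
  have hg : ∀ x, lam m n (g x) = x := fun x ↦ by
    change lam m n (MulOpposite.op x • p) = x
    rw [map_smul, hp, MulOpposite.smul_eq_mul_unop, one_mul, MulOpposite.unop_op]
  let e := MulOpposite.opLinearEquivSelf (GroupRing m n)
  exact ⟨1, ⟨(LinearEquiv.refl _ _).prodCongr
    (LinearEquiv.funUnique (Fin 1) _ _ ≪≫ₗ e.symm) ≪≫ₗ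
    LinearMap.kerProdEquivOfRightInverse (lam m n) g hg ≪≫ₗ
    (e.prodCongr e) ≪≫ₗ (LinearEquiv.finTwoArrow _ _).symm⟩⟩

/-- The augmentation maps the group ring to ℤ. -/
instance : InvariantBasisNumber (GroupRing m n) :=
  (MonoidAlgebra.lift ℤ ℤ (BaumslagSolitar m n) 1).toRingHom.invariantBasisNumber

/-- If the kernel of `lam` is free, then the kernel of every base change of `lam` is generated by
one element; only the second coordinates are recorded. -/
theorem exists_generator_of_free_ker_lam [Module.Free (GroupRing m n)ᵐᵒᵖ (LinearMap.ker (lam m n))]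
    {S : Type*} [Ring S] (φ : GroupRing m n →+* S) :
    ∃ v : S, (∃ x, φ (r m n) * x + φ (t m n) * v = 0) ∧
      ∀ x y, φ (r m n) * x + φ (t m n) * y = 0 → ∃ z, y = v * z := by
  obtain ⟨⟨⟨u, v⟩, huv⟩, hgen⟩ := (isStablyFreeOfRank_ker_lam m n).exists_generator
  replace huv : r m n * u + t m n * v = 0 := huv
  have hgen' : ∀ x y, r m n * x + t m n * y = 0 → ∃ z, y = v * z := fun x y hxy ↦ by
    obtain ⟨c, hc⟩ := hgen ⟨(x, y), hxy⟩
    exact ⟨c.unop, congrArg (fun k ↦ k.1.2) hc⟩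
  refine ⟨φ v, ⟨φ u, by rw [← map_mul, ← map_mul, ← map_add, huv, map_zero]⟩, fun x y hxy ↦ ?_⟩
  obtain ⟨⟨p, q⟩, hp⟩ := exists_lam_eq_one m n
  replace hp : r m n * p + t m n * q = 1 := hp
  -- `h₁` and `h₂` treat the two columns of the projection onto the kernel; its image under φ fixes
  -- every solution over `S`.
  obtain ⟨z₁, h₁⟩ := hgen' (1 - p * r m n) (-(q * r m n)) (by
    have : r m n * (1 - p * r m n) + t m n * -(q * r m n) =
      r m n - (r m n * p + t m n * q) * r m n := by noncomm_ring
    rw [this, hp, one_mul, sub_self])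
  obtain ⟨z₂, h₂⟩ := hgen' (-(p * t m n)) (1 - q * t m n) (by
    have : r m n * -(p * t m n) + t m n * (1 - q * t m n) =
      t m n - (r m n * p + t m n * q) * t m n := by noncomm_ring
    rw [this, hp, one_mul, sub_self])
  refine ⟨φ z₁ * x + φ z₂ * y, ?_⟩
  rw [mul_add, ← mul_assoc, ← mul_assoc, ← map_mul, ← map_mul, ← h₁, ← h₂]
  have : φ (-(q * r m n)) * x + φ (1 - q * t m n) * y =
      y - φ q * (φ (r m n) * x + φ (t m n) * y) := by
    simp only [map_neg, map_mul, map_sub, map_one]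
    noncomm_ring
  rw [this, hxy, mul_zero, sub_zero]

end BaumslagSolitar

/-! ### Divisibility and ideals in ℤ[ℚ] -/

/-- The positive rationals act on `ℤ[ℚ]` by scaling exponents. -/
noncomputable instance AddMonoidAlgebra.posRatMulSemiringAction :
    MulSemiringAction {q : ℚ // 0 < q} (AddMonoidAlgebra ℤ ℚ) where
  smul τ f := AddMonoidAlgebra.mapDomainRingHom ℤ (AddMonoidHom.mulLeft (τ : ℚ)) f
  one_smul f := by
    have h : AddMonoidHom.mulLeft ((1 : {q : ℚ // 0 < q}) : ℚ) = .id ℚ := by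
      ext
      simp
    change AddMonoidAlgebra.mapDomainRingHom ℤ _ f = f
    rw [h, AddMonoidAlgebra.mapDomainRingHom_id, RingHom.id_apply]
  mul_smul τ σ f := by
    have h : AddMonoidHom.mulLeft ((τ * σ : {q : ℚ // 0 < q}) : ℚ) =
        (AddMonoidHom.mulLeft (τ : ℚ)).comp (AddMonoidHom.mulLeft (σ : ℚ)) := by
      ext
      simp [mul_assoc]
    change AddMonoidAlgebra.mapDomainRingHom ℤ _ f = AddMonoidAlgebra.mapDomainRingHom ℤ _
      (AddMonoidAlgebra.mapDomainRingHom ℤ _ f)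
    rw [h, AddMonoidAlgebra.mapDomainRingHom_comp, RingHom.comp_apply]
  smul_zero τ := map_zero _
  smul_add τ := map_add _
  smul_one τ := map_one _
  smul_mul τ := map_mul _

theorem AddMonoidAlgebra.posRat_smul_single (τ : {q : ℚ // 0 < q}) (q : ℚ) (c : ℤ) :
    τ • (AddMonoidAlgebra.single q c) = AddMonoidAlgebra.single (τ * q) c :=
  AddMonoidAlgebra.mapDomain_single

/-- `u - 1` divides `u ^ k - 1` for integer exponents `k`. -/
theorem Units.sub_one_dvd_zpow_sub_one {R : Type*} [CommRing R] (u : Rˣ) (k : ℤ) :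
    (u - 1 : R) ∣ ((u ^ k : Rˣ) : R) - 1 := by
  obtain ⟨l, rfl | rfl⟩ := k.eq_nat_or_neg
  · simpa using sub_one_dvd_pow_sub_one (u : R) l
  · have h : ((u ^ (-(l : ℤ)) : Rˣ) : R) * (u ^ l - 1) = -(((u ^ (-(l : ℤ)) : Rˣ) : R) - 1) := by
      rw [mul_sub, ← Units.val_pow_eq_pow_val, ← Units.val_mul]
      simp
    rw [← dvd_neg, ← h]
    exact (sub_one_dvd_pow_sub_one (u : R) l).mul_left _

namespace BaumslagSolitar

open SkewMonoidAlgebra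

/-- The monomial `x ^ q` of `ℤ[ℚ]`. -/
noncomputable def ratMonomial : Multiplicative ℚ →* AddMonoidAlgebra ℤ ℚ :=
  AddMonoidAlgebra.of ℤ ℚ

theorem smul_ratMonomial (τ : {q : ℚ // 0 < q}) (q : ℚ) :
    τ • ratMonomial (.ofAdd q) = ratMonomial (.ofAdd (τ * q)) :=
  AddMonoidAlgebra.posRat_smul_single τ q 1

/-- The ideal `(1 + x ^ m, 1 + x ^ n)` of `ℤ[ℚ]` contains `2` if `|n - m| = 1`. -/
theorem exists_two_eq_add {m n : ℤ} (hmn : n = m + 1 ∨ n = m - 1) :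
    ∃ p q : AddMonoidAlgebra ℤ ℚ, 2 = p * (1 + ratMonomial (.ofAdd (n : ℚ))) +
      q * (1 + ratMonomial (.ofAdd (m : ℚ))) := by
  obtain ⟨ε, hε, hn⟩ : ∃ ε : ℤ, ε * ε = 1 ∧ n = ε + m := by
    rcases hmn with h | h
    · exact ⟨1, by norm_num, by omega⟩
    · exact ⟨-1, by norm_num, by omega⟩
  let u := ratMonomial.toHomUnits (.ofAdd (ε : ℚ))
  have hu : (u : AddMonoidAlgebra ℤ ℚ) = ratMonomial (.ofAdd (ε : ℚ)) := rfl
  obtain ⟨d, hd⟩ := u.sub_one_dvd_zpow_sub_one (ε * m)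
  have hm : ((u ^ (ε * m) : (AddMonoidAlgebra ℤ ℚ)ˣ) : AddMonoidAlgebra ℤ ℚ) =
      ratMonomial (.ofAdd (m : ℚ)) := by
    rw [← map_zpow, MonoidHom.coe_toHomUnits, ← ofAdd_zsmul, zsmul_eq_mul]
    congr 2
    exact_mod_cast (by linear_combination m * hε : ε * m * ε = m)
  have hn' : ratMonomial (.ofAdd (n : ℚ)) = u * ratMonomial (.ofAdd (m : ℚ)) := by
    rw [hu, ← map_mul, ← ofAdd_add, hn]
    push_cast
    rfl
  rw [hm] at hd
  -- Modulo both generators x^m = x^n = -1, so u = 1; but x^m is a power of u, so 2 = 0.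
  refine ⟨d, 1 - d * u, ?_⟩
  rw [hn']
  linear_combination -hd

/-- `1 + x ^ m` does not divide `2 (1 + x ^ n)` in `ℤ[ℚ]` if `|n - m| = 1`. -/
theorem not_one_add_dvd {m n : ℤ} (hm : m ≠ 0) (hmn : n = m + 1 ∨ n = m - 1) :
    ¬ 1 + ratMonomial (.ofAdd (m : ℚ)) ∣ 2 * (1 + ratMonomial (.ofAdd (n : ℚ))) := by
  rintro ⟨d, hd⟩
  -- Evaluation at x = exp(πi/m), a root of 1 + x^m.
  let χ : Multiplicative ℚ →* ℂ :=
    { toFun := fun q ↦ Complex.exp (q.toAdd / m * (Real.pi * Complex.I))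
      map_one' := by simp
      map_mul' := fun p q ↦ by
        rw [← Complex.exp_add]
        congr 1
        push_cast [toAdd_mul]
        ring }
  let ψ := AddMonoidAlgebra.lift ℤ ℂ ℚ χ
  have hψ : ∀ q : ℚ, ψ (ratMonomial (.ofAdd q)) =
      Complex.exp (q / m * (Real.pi * Complex.I)) := fun q ↦
    AddMonoidAlgebra.lift_of _ _
  have hm' : (m : ℂ) ≠ 0 := by exact_mod_cast hm
  have h := congrArg ψ hd
  rw [map_mul, map_mul, map_add, map_add, hψ, hψ, map_one, map_ofNat, Rat.cast_intCast,
    Rat.cast_intCast, div_self hm', one_mul, Complex.exp_pi_mul_I, add_neg_cancel, zero_mul,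
    mul_eq_zero, or_iff_right two_ne_zero, add_eq_zero_iff_neg_eq, ← Complex.exp_pi_mul_I,
    Complex.exp_eq_exp_iff_exists_int] at h
  obtain ⟨k, hk⟩ := h
  have hpi : (Real.pi * Complex.I : ℂ) ≠ 0 :=
    mul_ne_zero (by exact_mod_cast Real.pi_ne_zero) Complex.I_ne_zero
  have h1 : (m : ℂ) = n + 2 * k * m := by
    have : (1 : ℂ) = n / m + 2 * k := mul_right_cancel₀ hpi (by linear_combination hk)
    field_simp at this
    linear_combination this
  have h2 : m = n + 2 * k * m := by exact_mod_cast h1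
  -- Parity contradicts m - n = ±1.
  have h3 : (2 : ℤ) ∣ m - n := ⟨k * m, by linear_combination h2⟩
  omega

/-! ### The map to the skew group ring and non-freeness -/

/-- The scaling factor `n / m` as a positive rational number. -/
def ratio {m n : ℤ} (h : 0 < (n / m : ℚ)) : {q : ℚ // 0 < q} := ⟨n / m, h⟩

/-- The skew group ring of the positive rationals over `ℤ[ℚ]`. -/
abbrev RatSkewRing : Type := SkewMonoidAlgebra (AddMonoidAlgebra ℤ ℚ) {q : ℚ // 0 < q}

/-- The monomials `x ^ q` as units of the skew group ring. -/
noncomputable def baseUnit : Multiplicative ℚ →* RatSkewRingˣ :=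
  MonoidHom.toHomUnits
    { toFun := fun q ↦ single 1 (ratMonomial q)
      map_one' := by rw [map_one, single_one_one]
      map_mul' := fun p q ↦ by rw [map_mul, single_mul_single, one_smul, one_mul] }

/-- The group elements as units of the skew group ring. -/
noncomputable def scaleUnit : {q : ℚ // 0 < q} →* RatSkewRingˣ :=
  MonoidHom.toHomUnits
    { toFun := fun τ ↦ single τ 1
      map_one' := single_one_one
      map_mul' := fun σ τ ↦ by rw [single_mul_single, smul_one, one_mul] }

theorem baseUnit_zpow (k : ℤ) :
    (baseUnit (.ofAdd 1) ^ k : RatSkewRingˣ) = baseUnit (.ofAdd (k : ℚ)) := by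
  rw [← map_zpow, ← ofAdd_zsmul, zsmul_one]

theorem coe_baseUnit (q : ℚ) :
    (baseUnit (.ofAdd q) : RatSkewRing) = single 1 (ratMonomial (.ofAdd q)) := rfl

theorem coe_scaleUnit (τ : {q : ℚ // 0 < q}) : (scaleUnit τ : RatSkewRing) = single τ 1 := rfl

theorem ratio_mul {m n : ℤ} (hm : m ≠ 0) (h : 0 < (n / m : ℚ)) :
    (ratio h : ℚ) * m = n :=
  div_mul_cancel₀ _ (by exact_mod_cast hm)

/-- The homomorphism `BS(m,n) → ℚ ⋊ ℚ_{>0}` taking `a` to a translation by `1` and `b` to the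
scaling by `n / m`, composed with the inclusion into the units of the skew group ring. -/
noncomputable def toUnits {m n : ℤ} (hm : m ≠ 0) (h : 0 < (n / m : ℚ)) :
    BaumslagSolitar m n →* RatSkewRingˣ :=
  PresentedGroup.toGroup (f := ![baseUnit (.ofAdd 1), scaleUnit (ratio h)]) (by
    rintro _ rfl
    simp only [map_mul, map_inv, map_zpow, FreeGroup.lift_apply_of, Matrix.cons_val_zero,
      Matrix.cons_val_one]
    rw [mul_inv_eq_one, mul_inv_eq_iff_eq_mul, baseUnit_zpow, baseUnit_zpow]
    ext1
    rw [Units.val_mul, Units.val_mul, coe_baseUnit, coe_baseUnit, coe_scaleUnit,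
      single_mul_single, single_mul_single, smul_ratMonomial, ratio_mul hm, one_smul, one_mul,
      mul_one, mul_one, one_mul])

theorem toUnits_a {m n : ℤ} (hm : m ≠ 0) (h : 0 < (n / m : ℚ)) :
    toUnits hm h (a m n) = baseUnit (.ofAdd 1) := by
  rw [toUnits, a, PresentedGroup.toGroup.of]
  rfl

theorem toUnits_b {m n : ℤ} (hm : m ≠ 0) (h : 0 < (n / m : ℚ)) :
    toUnits hm h (b m n) = scaleUnit (ratio h) := by
  rw [toUnits, b, PresentedGroup.toGroup.of]
  rfl

/-- The homomorphism of `ℤBS(m,n)` to the skew group ring. -/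
noncomputable def toRatSkewRing {m n : ℤ} (hm : m ≠ 0) (h : 0 < (n / m : ℚ)) :
    GroupRing m n →+* RatSkewRing :=
  (MonoidAlgebra.lift ℤ RatSkewRing (BaumslagSolitar m n)
    ((Units.coeHom _).comp (toUnits hm h))).toRingHom

theorem toRatSkewRing_of {m n : ℤ} (hm : m ≠ 0) (h : 0 < (n / m : ℚ)) (g : BaumslagSolitar m n) :
    toRatSkewRing hm h (MonoidAlgebra.of ℤ _ g) = toUnits hm h g :=
  MonoidAlgebra.lift_of _ _

theorem toRatSkewRing_r {m n : ℤ} (hm : m ≠ 0) (h : 0 < (n / m : ℚ)) :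
    toRatSkewRing hm h (r m n) = single 1 (1 + ratMonomial (.ofAdd (m : ℚ))) := by
  rw [r, map_add, map_one, toRatSkewRing_of, map_zpow, toUnits_a, baseUnit_zpow, coe_baseUnit,
    single_add, single_one_one]

theorem toRatSkewRing_t {m n : ℤ} (hm : m ≠ 0) (h : 0 < (n / m : ℚ)) :
    toRatSkewRing hm h (t m n) =
      single (ratio h) 1 + single 1 (1 + ratMonomial (.ofAdd (n : ℚ))) := by
  rw [t, map_add, map_add, map_one, toRatSkewRing_of, toRatSkewRing_of, map_zpow, toUnits_a,
    toUnits_b, baseUnit_zpow, coe_baseUnit, coe_scaleUnit, single_add, single_one_one, add_assoc]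

theorem not_free_ker_lam {m n : ℤ} (hm : m ≠ 0) (hn : n ≠ 0) (hmn : n = m + 1 ∨ n = m - 1) :
    ¬ Module.Free (GroupRing m n)ᵐᵒᵖ (LinearMap.ker (lam m n)) := by
  intro hfree
  have hpos : 0 < (n / m : ℚ) := by
    rcases lt_or_gt_of_ne hm with h | h
    · exact div_pos_of_neg_of_neg (by exact_mod_cast (by omega : n < 0)) (by exact_mod_cast h)
    · exact div_pos (by exact_mod_cast (by omega : 0 < n)) (by exact_mod_cast h)
  have hgen := exists_generator_of_free_ker_lam m n (toRatSkewRing hm hpos)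
  have hsmul : ratio hpos • (1 + ratMonomial (.ofAdd (m : ℚ))) =
      1 + ratMonomial (.ofAdd (n : ℚ)) := by
    rw [smul_add, smul_one, smul_ratMonomial, ratio_mul hm]
  rw [toRatSkewRing_r, toRatSkewRing_t, ← hsmul] at hgen
  have htwo : ∀ τ : {q : ℚ // 0 < q}, τ • (2 : AddMonoidAlgebra ℤ ℚ) = 2 := fun τ ↦ by
    rw [← one_add_one_eq_two, smul_add, smul_one]
  obtain ⟨p, q, hpq⟩ := exists_two_eq_add hmn
  -- Acting by β⁻¹ on `hpq` fixes 2 and turns the pair s, r into r, β⁻¹ • r.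
  refine not_exists_generator (β := ratio hpos) (w := 2) (p := (ratio hpos)⁻¹ • p)
    (q := (ratio hpos)⁻¹ • q) ?_ ?_ ?_ hgen
  · intro h
    have := ratio_mul hm hpos
    rw [h, Positive.val_one, one_mul] at this
    have : m = n := by exact_mod_cast this
    omega
  · rw [htwo, ← htwo (ratio hpos)⁻¹, hpq, ← hsmul, smul_add, smul_mul', smul_mul', inv_smul_smul]
  · rw [smul_mul', hsmul, htwo]
    exact not_one_add_dvd hm hmn

end BaumslagSolitar

theorem theoremD (m n : ℤ) (hm : m ≠ 0) (hn : n ≠ 0) (hmn : n = m + 1 ∨ n = m - 1) :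
    Module.IsStablyFree (BaumslagSolitar.GroupRing m n)ᵐᵒᵖ
        (LinearMap.ker (BaumslagSolitar.lam m n)) ∧
      IsStablyFreeOfRank (BaumslagSolitar.GroupRing m n)ᵐᵒᵖ
        (LinearMap.ker (BaumslagSolitar.lam m n)) 1 ∧
      ¬ Module.Free (BaumslagSolitar.GroupRing m n)ᵐᵒᵖ
        (LinearMap.ker (BaumslagSolitar.lam m n)) :=
  ⟨(BaumslagSolitar.isStablyFreeOfRank_ker_lam m n).isStablyFree,
    BaumslagSolitar.isStablyFreeOfRank_ker_lam m n, BaumslagSolitar.not_free_ker_lam hm hn hmn⟩
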